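/- Let $n$ be a natural number and let $x=(x_1,\dots,x_n)$, $\tilde x=(\tilde x_1,\dots,\tilde x_n)$ and $w=(w_1,\dots,w_n)$ be random vectors in $\mathbb{R}^n$ on one probability space such that - $x_1,\dots,x_n$ are independent and each $x_i$ takes the values $+1$ and $-1$ with probability $1/2$ each; - $\tilde x$ and $w$ are standard Gaussian vectors (law $N(0,I_n)$); - $w$ is independent of $x$, and $w$ is independent of $\tilde x$. For random vectors $X,Y$ let $I[X;Y]=D(P_{(X,Y)}\,\|\,P_X\otimes P_Y)\in[0,\infty]$ denote their mutual information (natural logarithm). Then for every signal-to-noise ratio $\rho>0$ the mutual informations $I[x;\sqrt{\rho}\,x+w]$ and $I[\tilde x;\sqrt{\rho}\,\tilde x+w]$ are finite, both are differentiable as functions of $\rho$, and $$\frac{d}{d\rho}\,I[x;\sqrt{\rho}\,x+w]\;\le\;\frac{d}{d\rho}\,I[\tilde x;\sqrt{\rho}\,\tilde x+w].$$ -/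

import Mathlib

open MeasureTheory ProbabilityTheory
open scoped ENNReal

noncomputable section

/-- The mutual information `I[X; Y]` (in nats) of two random elements on `(Ω, P)`: the
Kullback-Leibler divergence of their joint law from the product of their marginal laws. -/
def mutualInformation {Ω E F : Type*} [MeasurableSpace Ω] [MeasurableSpace E] [MeasurableSpace F]
    (P : Measure Ω) (X : Ω → E) (Y : Ω → F) : ℝ≥0∞ :=
  InformationTheory.klDiv (P.map (fun ω => (X ω, Y ω))) ((P.map X).prod (P.map Y))

/-- The law of the equiprobable binary input: the values `1` and `-1` with probability `1/2` each. -/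
def equiprobableBinary : Measure ℝ :=
  (2⁻¹ : ℝ≥0∞) • Measure.dirac (1 : ℝ) + (2⁻¹ : ℝ≥0∞) • Measure.dirac (-1 : ℝ)

/-- The output `√ρ x + w` of the Gaussian channel with signal-to-noise ratio `ρ`, input `x`
and noise `w`. -/
def gaussianChannelOutput {Ω : Type*} {n : ℕ} (ρ : ℝ) (x w : Ω → EuclideanSpace ℝ (Fin n)) :
    Ω → EuclideanSpace ℝ (Fin n) :=
  fun ω => √ρ • x ω + w ω

end

/-!
# Derivative of the mutual information: binary against Gaussian input

For an input with independent components of common law `ν`, the law of `(x, √ρ x + w)` and the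
product of its marginals both have densities with respect to `law x ⊗ N(0, I)`, by the
Cameron-Martin formula (`lintegral_const_add_stdGaussian`); the densities factor over the
coordinates, so the mutual information is `n` times the mean of a scalar log-likelihood ratio
(`mutualInformation_gaussianChannelOutput`). With `Z` of law `N(0, 1)` and `U = ρ + √ρ Z`, this
gives `n (ρ - E log cosh U)` for the binary input and `n log (1 + ρ) / 2` for the Gaussian one
(`mutualInformation_binary`, `mutualInformation_gaussian`).

Given the scalar binary input `1`, the variable `U` is `√ρ` times the output, and `tanh U` is the
posterior mean of the input. Reflecting `U` shows `E [h(U) (1 - tanh U)] = 0` for odd `h`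
(`integral_odd_mul_one_sub_tanh`). With `h = id`, differentiation under the integral sign gives the
derivative `(1 - E tanh U) / 2` (`hasDerivAt_binary_information`), half of the minimum mean square
error. With `h = id` and `h = tanh`, expanding `0 ≤ E (tanh U - U / (1 + ρ))²`, the comparison with
the best linear estimator, gives `E tanh U ≥ ρ / (1 + ρ)`
(`div_one_add_le_integral_tanh`). This is the claim, since `1 - ρ / (1 + ρ) = 1 / (1 + ρ)` and
the derivative of `log (1 + ρ) / 2` is `1 / (2 (1 + ρ))`.
-/

/-! ### Gaussian shifts -/

/-- The density `y ↦ exp (a y - a² / 2)` of `N(a, 1)` with respect to `N(0, 1)`. -/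
noncomputable def gaussianShiftDensity (a y : ℝ) : ℝ := Real.exp (a * y - a ^ 2 / 2)

lemma gaussianShiftDensity_pos (a y : ℝ) : 0 < gaussianShiftDensity a y := Real.exp_pos _

@[fun_prop]
lemma measurable_gaussianShiftDensity {α : Type*} [MeasurableSpace α] {f g : α → ℝ}
    (hf : Measurable f) (hg : Measurable g) :
    Measurable (fun z => gaussianShiftDensity (f z) (g z)) := by
  unfold gaussianShiftDensity; fun_prop

lemma gaussianReal_map_const_add_eq_withDensity (a : ℝ) :
    (gaussianReal 0 1).map (a + ·) =
      (gaussianReal 0 1).withDensity (fun y => ENNReal.ofReal (gaussianShiftDensity a y)) := by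
  rw [gaussianReal_map_const_add, gaussianReal_of_var_ne_zero _ one_ne_zero,
    gaussianReal_of_var_ne_zero _ one_ne_zero,
    ← withDensity_mul _ (measurable_gaussianPDF _ _) (by fun_prop)]
  congr 1
  ext y
  simp only [gaussianPDF, gaussianPDFReal, gaussianShiftDensity, Pi.mul_apply]
  rw [← ENNReal.ofReal_mul (by positivity), mul_assoc _ (Real.exp _), ← Real.exp_add]
  congr 3
  simp
  ring

lemma lintegral_pi_prod {ι : Type*} [Fintype ι] {α : ι → Type*} [∀ i, MeasurableSpace (α i)]
    (μ : ∀ i, Measure (α i)) [∀ i, IsProbabilityMeasure (μ i)] {f : ∀ i, α i → ℝ≥0∞}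
    (hf : ∀ i, Measurable (f i)) :
    ∫⁻ x, ∏ i, f i (x i) ∂Measure.pi μ = ∏ i, ∫⁻ t, f i t ∂μ i := by
  rw [lintegral_prod_eq_prod_lintegral_of_indepFun Finset.univ (fun i (x : ∀ i, α i) => f i (x i))
    (iIndepFun_pi fun i => (hf i).aemeasurable) (fun i => by fun_prop)]
  refine Finset.prod_congr rfl fun i _ => ?_
  exact (measurePreserving_eval μ i).lintegral_comp (hf i)

lemma pi_withDensity {ι : Type*} [Fintype ι] {α : ι → Type*} [∀ i, MeasurableSpace (α i)]
    (μ : ∀ i, Measure (α i)) [∀ i, IsProbabilityMeasure (μ i)] {f : ∀ i, α i → ℝ≥0∞}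
    (hf : ∀ i, Measurable (f i)) [∀ i, SigmaFinite ((μ i).withDensity (f i))] :
    Measure.pi (fun i => (μ i).withDensity (f i)) =
      (Measure.pi μ).withDensity (fun x => ∏ i, f i (x i)) := by
  refine Measure.pi_eq fun s hs => ?_
  rw [withDensity_apply _ (.univ_pi hs), ← lintegral_indicator (.univ_pi hs)]
  have h : (Set.univ.pi s).indicator (fun x : ∀ i, α i => ∏ i, f i (x i)) =
      fun x => ∏ i, (s i).indicator (f i) (x i) := by
    ext x
    by_cases hx : x ∈ Set.univ.pi s
    · rw [Set.indicator_of_mem hx]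
      exact Finset.prod_congr rfl fun i _ => (Set.indicator_of_mem (hx i trivial) _).symm
    · rw [Set.indicator_of_notMem hx]
      obtain ⟨i, hi⟩ : ∃ i, x i ∉ s i := by simpa [Set.mem_pi] using hx
      exact (Finset.prod_eq_zero (Finset.mem_univ i) (Set.indicator_of_notMem hi _)).symm
  rw [h, lintegral_pi_prod μ fun i => (hf i).indicator (hs i)]
  refine Finset.prod_congr rfl fun i _ => ?_
  rw [withDensity_apply _ (hs i), lintegral_indicator (hs i)]

/-- The law on `EuclideanSpace ℝ (Fin n)` of a vector with independent components of law `ν`. -/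
noncomputable def euclideanPi (n : ℕ) (ν : Measure ℝ) : Measure (EuclideanSpace ℝ (Fin n)) :=
  (Measure.pi fun _ : Fin n => ν).map (WithLp.toLp 2)

instance (n : ℕ) (ν : Measure ℝ) [IsProbabilityMeasure ν] :
    IsProbabilityMeasure (euclideanPi n ν) :=
  Measure.isProbabilityMeasure_map (by fun_prop)

lemma lintegral_euclideanPi {n : ℕ} (ν : Measure ℝ) {g : EuclideanSpace ℝ (Fin n) → ℝ≥0∞}
    (hg : Measurable g) :
    ∫⁻ x, g x ∂euclideanPi n ν = ∫⁻ x, g (WithLp.toLp 2 x) ∂Measure.pi fun _ => ν :=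
  lintegral_map hg (by fun_prop)

/-- The Cameron-Martin formula for the standard Gaussian measure. -/
lemma lintegral_const_add_stdGaussian {n : ℕ} (a : EuclideanSpace ℝ (Fin n))
    {g : EuclideanSpace ℝ (Fin n) → ℝ≥0∞} (hg : Measurable g) :
    ∫⁻ w, g (a + w) ∂stdGaussian (EuclideanSpace ℝ (Fin n)) =
      ∫⁻ y, (∏ i, ENNReal.ofReal (gaussianShiftDensity (a i) (y i))) * g y
        ∂stdGaussian (EuclideanSpace ℝ (Fin n)) := by
  rw [← map_pi_eq_stdGaussian, lintegral_map (by fun_prop) (by fun_prop),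
    lintegral_map (by fun_prop) (by fun_prop)]
  have : ∀ i, IsProbabilityMeasure ((gaussianReal 0 1).withDensity
      (fun y => ENNReal.ofReal (gaussianShiftDensity (a i) y))) := fun i => by
    rw [← gaussianReal_map_const_add_eq_withDensity]
    exact Measure.isProbabilityMeasure_map (by fun_prop)
  have h : (Measure.pi fun _ : Fin n => gaussianReal 0 1).map (fun w i => a i + w i) =
      (Measure.pi fun _ => gaussianReal 0 1).withDensity
        (fun y => ∏ i, ENNReal.ofReal (gaussianShiftDensity (a i) (y i))) := by
    rw [← pi_withDensity (fun _ : Fin n => gaussianReal 0 1)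
      (f := fun i y => ENNReal.ofReal (gaussianShiftDensity (a i) y)) (fun i => by fun_prop),
      Measure.pi_map_pi (f := fun i t => a i + t) (fun i => by fun_prop)]
    simp_rw [gaussianReal_map_const_add_eq_withDensity]
  calc _ = ∫⁻ y, g (WithLp.toLp 2 y)
        ∂(Measure.pi fun _ : Fin n => gaussianReal 0 1).map (fun w i => a i + w i) := by
        rw [lintegral_map (by fun_prop) (by fun_prop)]; rfl
    _ = _ := by
        rw [h, lintegral_withDensity_eq_lintegral_mul _ (by fun_prop) (by fun_prop)]; rfl

/-! ### Mutual information of the channel with independent identically distributed inputs -/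

lemma klDiv_withDensity_withDensity {α : Type*} [MeasurableSpace α] {κ : Measure α} [SigmaFinite κ]
    {p q : α → ℝ} (hp : Measurable p) (hq : Measurable q) (hp0 : ∀ z, 0 < p z) (hq0 : ∀ z, 0 < q z)
    [IsProbabilityMeasure (κ.withDensity fun z => ENNReal.ofReal (p z))]
    [IsProbabilityMeasure (κ.withDensity fun z => ENNReal.ofReal (q z))]
    (hint : Integrable (fun z => Real.log (p z) - Real.log (q z))
      (κ.withDensity fun z => ENNReal.ofReal (p z))) :
    InformationTheory.klDiv (κ.withDensity fun z => ENNReal.ofReal (p z))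
        (κ.withDensity fun z => ENNReal.ofReal (q z)) ≠ ∞ ∧
      (InformationTheory.klDiv (κ.withDensity fun z => ENNReal.ofReal (p z))
        (κ.withDensity fun z => ENNReal.ofReal (q z))).toReal =
      ∫ z, (Real.log (p z) - Real.log (q z)) ∂(κ.withDensity fun z => ENNReal.ofReal (p z)) := by
  set μ := κ.withDensity fun z => ENNReal.ofReal (p z) with hμ
  set ν := κ.withDensity fun z => ENNReal.ofReal (q z) with hν
  have hμν : μ = ν.withDensity fun z => ENNReal.ofReal (p z / q z) := by
    rw [hν, ← withDensity_mul _ (by fun_prop) (by fun_prop), hμ]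
    congr 1
    ext z
    rw [Pi.mul_apply, ← ENNReal.ofReal_mul (hq0 z).le, mul_div_cancel₀ _ (hq0 z).ne']
  have hac : μ ≪ ν := hμν ▸ withDensity_absolutelyContinuous _ _
  have hllr : llr μ ν =ᵐ[μ] fun z => Real.log (p z) - Real.log (q z) := by
    have h : μ.rnDeriv ν =ᵐ[ν] fun z => ENNReal.ofReal (p z / q z) := by
      conv_lhs => rw [hμν]
      exact Measure.rnDeriv_withDensity _ (by fun_prop)
    filter_upwards [hac.ae_le h] with z hz
    rw [llr, hz, ENNReal.toReal_ofReal (div_pos (hp0 z) (hq0 z)).le,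
      Real.log_div (hp0 z).ne' (hq0 z).ne']
  refine ⟨InformationTheory.klDiv_ne_top hac (hint.congr hllr.symm), ?_⟩
  rw [InformationTheory.toReal_klDiv_of_measure_eq hac (by simp), integral_congr_ae hllr]

/-- The log-likelihood ratio of the joint law of input and output of the scalar channel with gain
`s` to the product of their laws, as a function of input and noise; `f` is the density of the
output with respect to `N(0, 1)`. -/
noncomputable def informationDensity (s : ℝ) (f : ℝ → ℝ) (z : ℝ × ℝ) : ℝ :=
  Real.log (gaussianShiftDensity (s * z.1) (s * z.1 + z.2)) - Real.log (f (s * z.1 + z.2))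

/-- For inputs with independent components of law `ν`, the mutual information is `n` times the mean
of the scalar information density. -/
lemma mutualInformation_gaussianChannelOutput {Ω : Type*} [MeasurableSpace Ω] {P : Measure Ω}
    [IsProbabilityMeasure P] {n : ℕ} {x w : Ω → EuclideanSpace ℝ (Fin n)}
    {ν : Measure ℝ} [IsProbabilityMeasure ν]
    (hx : HasLaw x (euclideanPi n ν) P) (hw : HasLaw w (stdGaussian (EuclideanSpace ℝ (Fin n))) P)
    (hxw : IndepFun x w P) (r : ℝ) {f : ℝ → ℝ} (hf : Measurable f) (hf0 : ∀ y, 0 < f y)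
    (hfν : ∀ y, ∫⁻ t, ENNReal.ofReal (gaussianShiftDensity (√r * t) y) ∂ν = ENNReal.ofReal (f y))
    (hint : Integrable (informationDensity √r f) (ν.prod (gaussianReal 0 1))) :
    mutualInformation P x (gaussianChannelOutput r x w) ≠ ∞ ∧
      (mutualInformation P x (gaussianChannelOutput r x w)).toReal =
        n * ∫ z, informationDensity √r f z ∂(ν.prod (gaussianReal 0 1)) := by
  have hxm : AEMeasurable x P := hx.aemeasurable
  have hwm : AEMeasurable w P := hw.aemeasurable
  have hYm : AEMeasurable (gaussianChannelOutput r x w) P := by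
    unfold gaussianChannelOutput; fun_prop
  let p : EuclideanSpace ℝ (Fin n) × EuclideanSpace ℝ (Fin n) → ℝ := fun z => ∏ i, gaussianShiftDensity (√r * z.1 i) (z.2 i)
  let q : EuclideanSpace ℝ (Fin n) → ℝ := fun y => ∏ i, f (y i)
  have hpm : Measurable p := by fun_prop
  have hqm : Measurable q := by fun_prop
  have hp_prod : ∀ z, ENNReal.ofReal (p z) =
      ∏ i, ENNReal.ofReal (gaussianShiftDensity (√r * z.1 i) (z.2 i)) := fun z =>
    ENNReal.ofReal_prod_of_nonneg fun i _ => (gaussianShiftDensity_pos _ _).le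
  have hq_prod : ∀ y, ENNReal.ofReal (q y) = ∏ i, ENNReal.ofReal (f (y i)) := fun y =>
    ENNReal.ofReal_prod_of_nonneg fun i _ => (hf0 _).le
  have hjoint : P.map (fun ω => (x ω, gaussianChannelOutput r x w ω)) =
      ((euclideanPi n ν).prod (stdGaussian (EuclideanSpace ℝ (Fin n)))).withDensity fun z => ENNReal.ofReal (p z) := by
    refine Measure.ext_of_lintegral _ fun g hg => ?_
    rw [lintegral_map' hg.aemeasurable (hxm.prodMk hYm),
      lintegral_withDensity_eq_lintegral_mul _ (by fun_prop) hg]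
    have h1 := (hxw.hasLaw_prod hx hw).lintegral_comp
      (f := fun z : EuclideanSpace ℝ (Fin n) × EuclideanSpace ℝ (Fin n) => g (z.1, √r • z.1 + z.2)) (by fun_prop)
    refine (h1.trans ?_)
    rw [lintegral_prod _ (by fun_prop), lintegral_prod _ (by fun_prop)]
    refine lintegral_congr fun a => ?_
    rw [lintegral_const_add_stdGaussian (√r • a) (g := fun y => g (a, y)) (by fun_prop)]
    refine lintegral_congr fun y => ?_
    rw [Pi.mul_apply, hp_prod]
    rfl
  have hY : P.map (gaussianChannelOutput r x w) =
      (stdGaussian (EuclideanSpace ℝ (Fin n))).withDensity fun y => ENNReal.ofReal (q y) := by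
    have h1 : P.map (gaussianChannelOutput r x w) =
        (P.map (fun ω => (x ω, gaussianChannelOutput r x w ω))).map Prod.snd :=
      (AEMeasurable.map_map_of_aemeasurable measurable_snd.aemeasurable (hxm.prodMk hYm)).symm
    refine Measure.ext_of_lintegral _ fun g hg => ?_
    rw [h1, hjoint, lintegral_map hg (by fun_prop),
      lintegral_withDensity_eq_lintegral_mul _ (by fun_prop) (by fun_prop),
      lintegral_withDensity_eq_lintegral_mul _ (by fun_prop) hg,
      lintegral_prod_symm _ (by fun_prop)]
    refine lintegral_congr fun y => ?_
    simp only [Pi.mul_apply]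
    rw [lintegral_mul_const _ (by fun_prop), lintegral_euclideanPi _ (by fun_prop), hq_prod]
    simp_rw [hp_prod]
    rw [lintegral_pi_prod (fun _ : Fin n => ν)
      (f := fun i t => ENNReal.ofReal (gaussianShiftDensity (√r * t) (y i))) (by fun_prop)]
    simp_rw [hfν]
  have hprod : (P.map x).prod (P.map (gaussianChannelOutput r x w)) =
      ((euclideanPi n ν).prod (stdGaussian (EuclideanSpace ℝ (Fin n)))).withDensity fun z => ENNReal.ofReal (q z.2) := by
    rw [hx.map_eq, hY, prod_withDensity_right (by fun_prop)]
  -- the pair of scalar input and scalar noise in each coordinate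
  have hcoord : ∀ i, HasLaw (fun ω => (x ω i, w ω i)) (ν.prod (gaussianReal 0 1)) P := fun i => by
    have heval : ∀ (κ : Measure ℝ) [IsProbabilityMeasure κ],
        HasLaw (fun a : EuclideanSpace ℝ (Fin n) => a i) κ (euclideanPi n κ) := fun κ _ =>
      ⟨by fun_prop, by
        rw [euclideanPi, Measure.map_map (by fun_prop) (by fun_prop)]
        exact (measurePreserving_eval (fun _ : Fin n => κ) i).map_eq⟩
    have hxi : HasLaw (fun ω => x ω i) ν P := (heval ν).fun_comp hx
    have hwi : HasLaw (fun ω => w ω i) (gaussianReal 0 1) P :=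
      (heval (gaussianReal 0 1)).fun_comp (by rwa [euclideanPi, map_pi_eq_stdGaussian])
    exact IndepFun.hasLaw_prod hxi hwi
      (hxw.comp (φ := fun a : EuclideanSpace ℝ (Fin n) => a i) (ψ := fun a : EuclideanSpace ℝ (Fin n) => a i) (by fun_prop) (by fun_prop))
  have hFm : Measurable (informationDensity √r f) := by
    unfold informationDensity; fun_prop
  have hlog : ∀ ω, Real.log (p (x ω, gaussianChannelOutput r x w ω)) -
      Real.log (q (gaussianChannelOutput r x w ω)) =
      ∑ i, informationDensity √r f (x ω i, w ω i) := fun ω => by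
    simp only [p, q, informationDensity]
    rw [Real.log_prod fun i _ => (gaussianShiftDensity_pos _ _).ne',
      Real.log_prod fun i _ => (hf0 _).ne', ← Finset.sum_sub_distrib]
    simp [gaussianChannelOutput]
  have hsum : ∀ i, Integrable (fun ω => informationDensity √r f (x ω i, w ω i)) P := fun i => by
    have h := hint
    rw [← (hcoord i).map_eq] at h
    exact h.comp_aemeasurable (hcoord i).aemeasurable
  have hsum' : Integrable (fun ω => ∑ i, informationDensity √r f (x ω i, w ω i)) P :=
    integrable_finsetSum _ fun i _ => hsum i
  have : IsProbabilityMeasure (((euclideanPi n ν).prod (stdGaussian (EuclideanSpace ℝ (Fin n)))).withDensity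
      fun z => ENNReal.ofReal (p z)) := by
    rw [← hjoint]; exact Measure.isProbabilityMeasure_map (hxm.prodMk hYm)
  have : IsProbabilityMeasure (((euclideanPi n ν).prod (stdGaussian (EuclideanSpace ℝ (Fin n)))).withDensity
      fun z => ENNReal.ofReal (q z.2)) := by
    have := Measure.isProbabilityMeasure_map hxm
    have := Measure.isProbabilityMeasure_map hYm
    rw [← hprod]; infer_instance
  have hkl := klDiv_withDensity_withDensity (κ := (euclideanPi n ν).prod (stdGaussian (EuclideanSpace ℝ (Fin n))))
    hpm (q := fun z => q z.2) (by fun_prop)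
    (fun z => Finset.prod_pos fun i _ => gaussianShiftDensity_pos _ _)
    (fun z => Finset.prod_pos fun i _ => hf0 _) (by
      rw [← hjoint, integrable_map_measure (by fun_prop) (hxm.prodMk hYm)]
      exact hsum'.congr (.of_forall fun ω => (hlog ω).symm))
  rw [← hprod, ← hjoint, integral_map (hxm.prodMk hYm) (by fun_prop)] at hkl
  refine ⟨hkl.1, hkl.2.trans ?_⟩
  simp_rw [hlog]
  rw [integral_finsetSum _ fun i _ => hsum i]
  have hi : ∀ i, ∫ ω, informationDensity √r f (x ω i, w ω i) ∂P =
      ∫ z, informationDensity √r f z ∂(ν.prod (gaussianReal 0 1)) := fun i =>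
    (hcoord i).integral_comp (f := informationDensity √r f) hFm.aestronglyMeasurable
  simp [hi]

/-! ### The scalar channel: derivative and comparison -/

lemma continuous_tanh : Continuous Real.tanh := by
  rw [show Real.tanh = fun x => Real.sinh x / Real.cosh x from
    funext Real.tanh_eq_sinh_div_cosh]
  exact Real.continuous_sinh.div Real.continuous_cosh fun x => (Real.cosh_pos x).ne'

lemma hasDerivAt_log_cosh (u : ℝ) :
    HasDerivAt (fun u => Real.log (Real.cosh u)) (Real.tanh u) u := by
  rw [Real.tanh_eq_sinh_div_cosh]
  exact (Real.hasDerivAt_cosh u).log (Real.cosh_pos u).ne'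

lemma abs_log_cosh_le (u : ℝ) : |Real.log (Real.cosh u)| ≤ |u| := by
  rw [abs_of_nonneg (Real.log_nonneg (Real.one_le_cosh u)),
    Real.log_le_iff_le_exp (Real.cosh_pos u), Real.cosh_eq]
  have h1 := Real.exp_le_exp.2 (le_abs_self u)
  have h2 := Real.exp_le_exp.2 (neg_le_abs u)
  linarith

lemma integrable_id_gaussianReal (m : ℝ) (v : NNReal) :
    Integrable (fun z : ℝ => z) (gaussianReal m v) :=
  (memLp_id_gaussianReal (μ := m) (v := v) 1).integrable (by simp)

lemma integrable_sq_gaussianReal (m : ℝ) (v : NNReal) :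
    Integrable (fun z : ℝ => z ^ 2) (gaussianReal m v) :=
  (memLp_id_gaussianReal (μ := m) (v := v) 2).integrable_sq

lemma integral_sq_gaussianReal_zero_one : ∫ z, z ^ 2 ∂gaussianReal 0 1 = 1 := by
  have h := variance_fun_id_gaussianReal (μ := 0) (v := 1)
  rw [variance_eq_integral (by fun_prop)] at h
  simpa using h

lemma integrable_log_cosh_affine (a b : ℝ) :
    Integrable (fun z => Real.log (Real.cosh (a + b * z))) (gaussianReal 0 1) := by
  refine Integrable.mono' (g := fun z => |a + b * z|) ?_ ?_ ?_
  · exact ((integrable_const a).add ((integrable_id_gaussianReal 0 1).const_mul b)).abs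
  · exact Measurable.aestronglyMeasurable (by fun_prop)
  · exact .of_forall fun z => abs_log_cosh_le _

/-- Orthogonality for the binary input conditioned on the value `1`, with observation
`U = ρ + √ρ Z`: as `tanh U` is the posterior mean, `1 - tanh U` is orthogonal to odd functions of
`U`. The reflection `u ↦ -u` multiplies the density of `U` by `exp (-2 u)`. -/
lemma integral_odd_mul_one_sub_tanh {ρ : ℝ} (hρ : 0 < ρ) {h : ℝ → ℝ} (hodd : ∀ u, h (-u) = -h u) :
    ∫ z, h (ρ + √ρ * z) * (1 - Real.tanh (ρ + √ρ * z)) ∂gaussianReal 0 1 = 0 := by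
  rw [integral_gaussianReal_eq_integral_smul one_ne_zero]
  set k : ℝ → ℝ := fun z => gaussianPDFReal 0 1 z •
    (h (ρ + √ρ * z) * (1 - Real.tanh (ρ + √ρ * z)))
  have hs : √ρ * √ρ = ρ := Real.mul_self_sqrt hρ.le
  have hk : ∀ z, k (-2 * √ρ - z) = -k z := fun z => by
    have hU : ρ + √ρ * (-2 * √ρ - z) = -(ρ + √ρ * z) := by linear_combination -2 * hs
    have hpdf : gaussianPDFReal 0 1 (-2 * √ρ - z) =
        gaussianPDFReal 0 1 z * Real.exp (-2 * (ρ + √ρ * z)) := by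
      simp only [gaussianPDFReal]
      rw [mul_assoc _ (Real.exp _), ← Real.exp_add]
      congr 2
      simp only [NNReal.coe_one]
      linear_combination -2 * hs
    have htanh : ∀ u : ℝ, Real.exp (-2 * u) * (1 + Real.tanh u) = 1 - Real.tanh u := fun u => by
      have he : Real.exp (-2 * u) = Real.exp (-u) * Real.exp (-u) := by
        rw [← Real.exp_add]; ring_nf
      have h1 : Real.exp u * Real.exp (-u) = 1 := by rw [← Real.exp_add]; simp
      have h2 := Real.exp_pos u
      have h3 := Real.exp_pos (-u)
      rw [he, Real.tanh_eq]
      field_simp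
      linear_combination 2 * Real.exp (-u) * h1
    simp only [k, smul_eq_mul]
    rw [hU, hodd, Real.tanh_neg, hpdf, ← htanh (ρ + √ρ * z)]
    ring
  have h1 := integral_sub_left_eq_self k volume (-2 * √ρ)
  simp_rw [hk, integral_neg] at h1
  linarith

lemma integrable_mul_tanh_affine {f : ℝ → ℝ} (hf : Integrable f (gaussianReal 0 1)) (a b : ℝ) :
    Integrable (fun z => f z * Real.tanh (a + b * z)) (gaussianReal 0 1) := by
  have hm : AEStronglyMeasurable (fun z => Real.tanh (a + b * z)) (gaussianReal 0 1) :=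
    (continuous_tanh.comp (by fun_prop)).aestronglyMeasurable
  exact hf.mul_bdd (c := 1) hm (.of_forall fun z => (Real.abs_tanh_lt_one _).le)

lemma integrable_affine_gaussianReal (a b : ℝ) :
    Integrable (fun z => a + b * z) (gaussianReal 0 1) :=
  (integrable_const a).add ((integrable_id_gaussianReal 0 1).const_mul b)

lemma integral_affine_gaussianReal (a b : ℝ) : ∫ z, (a + b * z) ∂gaussianReal 0 1 = a := by
  rw [integral_add (integrable_const a) ((integrable_id_gaussianReal 0 1).const_mul b),
    integral_const_mul, integral_id_gaussianReal]
  simp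

lemma integral_affine_mul_tanh {ρ : ℝ} (hρ : 0 < ρ) :
    ∫ z, (ρ + √ρ * z) * Real.tanh (ρ + √ρ * z) ∂gaussianReal 0 1 = ρ := by
  have h := integral_odd_mul_one_sub_tanh hρ (h := fun u => u) (fun u => rfl)
  simp_rw [mul_sub, mul_one] at h
  rw [integral_sub (integrable_affine_gaussianReal _ _)
    (integrable_mul_tanh_affine (integrable_affine_gaussianReal _ _) _ _),
    integral_affine_gaussianReal] at h
  linarith

lemma integrable_tanh_affine (a b : ℝ) :
    Integrable (fun z => Real.tanh (a + b * z)) (gaussianReal 0 1) := by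
  simpa using integrable_mul_tanh_affine (integrable_const 1) a b

lemma integral_tanh_sq {ρ : ℝ} (hρ : 0 < ρ) :
    ∫ z, Real.tanh (ρ + √ρ * z) * Real.tanh (ρ + √ρ * z) ∂gaussianReal 0 1 =
      ∫ z, Real.tanh (ρ + √ρ * z) ∂gaussianReal 0 1 := by
  have h := integral_odd_mul_one_sub_tanh hρ (h := Real.tanh) Real.tanh_neg
  simp_rw [mul_sub, mul_one] at h
  rw [integral_sub (integrable_tanh_affine _ _)
    (integrable_mul_tanh_affine (integrable_tanh_affine _ _) _ _)] at h
  linarith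

lemma integrable_affine_sq (a b : ℝ) :
    Integrable (fun z => (a + b * z) ^ 2) (gaussianReal 0 1) := by
  have : (fun z : ℝ => (a + b * z) ^ 2) = fun z => (a ^ 2 + 2 * a * b * z) + b ^ 2 * z ^ 2 := by
    ext z; ring
  rw [this]
  exact (integrable_affine_gaussianReal _ _).add ((integrable_sq_gaussianReal 0 1).const_mul _)

lemma integral_affine_sq (a b : ℝ) :
    ∫ z, (a + b * z) ^ 2 ∂gaussianReal 0 1 = a ^ 2 + b ^ 2 := by
  have : (fun z : ℝ => (a + b * z) ^ 2) = fun z => (a ^ 2 + 2 * a * b * z) + b ^ 2 * z ^ 2 := by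
    ext z; ring
  rw [this, integral_add (integrable_affine_gaussianReal _ _)
    ((integrable_sq_gaussianReal 0 1).const_mul _), integral_affine_gaussianReal,
    integral_const_mul, integral_sq_gaussianReal_zero_one, mul_one]

/-- The posterior mean `tanh U` has mean square error at most that of the best linear
estimator `U / (1 + ρ)`. -/
lemma div_one_add_le_integral_tanh {ρ : ℝ} (hρ : 0 < ρ) :
    ρ / (1 + ρ) ≤ ∫ z, Real.tanh (ρ + √ρ * z) ∂gaussianReal 0 1 := by
  have h0 : 0 ≤ ∫ z, (Real.tanh (ρ + √ρ * z) - (ρ + √ρ * z) / (1 + ρ)) ^ 2 ∂gaussianReal 0 1 :=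
    integral_nonneg fun z => sq_nonneg _
  have he : ∀ z, (Real.tanh (ρ + √ρ * z) - (ρ + √ρ * z) / (1 + ρ)) ^ 2 =
      Real.tanh (ρ + √ρ * z) * Real.tanh (ρ + √ρ * z)
        - 2 / (1 + ρ) * ((ρ + √ρ * z) * Real.tanh (ρ + √ρ * z))
        + (1 / (1 + ρ)) ^ 2 * (ρ + √ρ * z) ^ 2 := fun z => by ring
  simp_rw [he] at h0
  have i1 := integrable_mul_tanh_affine (integrable_tanh_affine ρ √ρ) ρ √ρ
  have i2 := (integrable_mul_tanh_affine
    (integrable_affine_gaussianReal ρ √ρ) ρ √ρ).const_mul (2 / (1 + ρ))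
  have i3 := (integrable_affine_sq ρ √ρ).const_mul ((1 / (1 + ρ)) ^ 2)
  rw [integral_add (by exact i1.sub i2) i3, integral_sub i1 i2, integral_const_mul, integral_const_mul,
    integral_affine_sq, integral_affine_mul_tanh hρ, integral_tanh_sq hρ, Real.sq_sqrt hρ.le] at h0
  have : 2 / (1 + ρ) * ρ - (1 / (1 + ρ)) ^ 2 * (ρ ^ 2 + ρ) = ρ / (1 + ρ) := by
    field_simp; ring
  linarith

/-- The derivative in the signal-to-noise ratio of the information of the scalar binary channel,
which is half of its minimum mean square error `1 - E tanh U`. -/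
lemma hasDerivAt_binary_information {ρ : ℝ} (hρ : 0 < ρ) :
    HasDerivAt (fun r => r - ∫ z, Real.log (Real.cosh (r + √r * z)) ∂gaussianReal 0 1)
      ((1 - ∫ z, Real.tanh (ρ + √ρ * z) ∂gaussianReal 0 1) / 2) ρ := by
  have key := hasDerivAt_integral_of_dominated_loc_of_deriv_le (μ := gaussianReal 0 1)
    (F := fun r z => Real.log (Real.cosh (r + √r * z)))
    (F' := fun r z => Real.tanh (r + √r * z) * (1 + 1 / (2 * √r) * z))
    (bound := fun z => 1 + 1 / (2 * √(ρ / 2)) * |z|)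
    (s := Set.Ioi (ρ / 2)) (x₀ := ρ) (Ioi_mem_nhds (by linarith))
    (.of_forall fun r => (integrable_log_cosh_affine r √r).aestronglyMeasurable)
    (integrable_log_cosh_affine ρ √ρ)
    (by
      have := (integrable_mul_tanh_affine (integrable_affine_gaussianReal 1 (1 / (2 * √ρ)))
        ρ √ρ).aestronglyMeasurable
      simpa only [mul_comm] using this)
    (by
      refine .of_forall fun z r hr => ?_
      have hr' : ρ / 2 < r := hr
      have h1 : √(ρ / 2) ≤ √r := Real.sqrt_le_sqrt hr'.le
      have h2 : 0 < √(ρ / 2) := Real.sqrt_pos.2 (by positivity)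
      rw [norm_mul, Real.norm_eq_abs, Real.norm_eq_abs]
      calc _ ≤ 1 * |1 + 1 / (2 * √r) * z| := by
            gcongr; exact (Real.abs_tanh_lt_one _).le
        _ ≤ |1| + |1 / (2 * √r) * z| := by rw [one_mul]; exact abs_add_le _ _
        _ = 1 + 1 / (2 * √r) * |z| := by
            rw [abs_mul, abs_one, abs_of_nonneg (a := 1 / (2 * √r)) (by positivity)]
        _ ≤ _ := by gcongr)
    ((integrable_const 1).add ((integrable_id_gaussianReal 0 1).abs.const_mul _))
    (by
      refine .of_forall fun z r hr => ?_
      have hr0 : 0 < r := by have : ρ / 2 < r := hr; linarith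
      have hin : HasDerivAt (fun r : ℝ => r + √r * z) (1 + 1 / (2 * √r) * z) r :=
        (hasDerivAt_id r).add ((Real.hasDerivAt_sqrt hr0.ne').mul_const z)
      exact (hasDerivAt_log_cosh _).comp r hin)
  have hval : ∫ z, Real.tanh (ρ + √ρ * z) * (1 + 1 / (2 * √ρ) * z) ∂gaussianReal 0 1 =
      (1 + ∫ z, Real.tanh (ρ + √ρ * z) ∂gaussianReal 0 1) / 2 := by
    have hs : √ρ * √ρ = ρ := Real.mul_self_sqrt hρ.le
    have hs0 : √ρ ≠ 0 := (Real.sqrt_pos.2 hρ).ne'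
    -- `1 + z / (2 √ρ) = 1 / 2 + U / (2 ρ)` with `U = ρ + √ρ z`
    have he : ∀ z, Real.tanh (ρ + √ρ * z) * (1 + 1 / (2 * √ρ) * z) =
        1 / 2 * Real.tanh (ρ + √ρ * z) +
          1 / (2 * ρ) * ((ρ + √ρ * z) * Real.tanh (ρ + √ρ * z)) := fun z => by
      have : 1 + 1 / (2 * √ρ) * z = 1 / 2 + 1 / (2 * ρ) * (ρ + √ρ * z) := by
        have h3 : 1 / (2 * √ρ) = 1 / (2 * ρ) * √ρ := by
          field_simp; nlinarith
        rw [h3]; field_simp; ring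
      rw [this]; ring
    simp_rw [he]
    rw [integral_add ((integrable_tanh_affine _ _).const_mul _)
      ((integrable_mul_tanh_affine (integrable_affine_gaussianReal _ _) _ _).const_mul _),
      integral_const_mul, integral_const_mul, integral_affine_mul_tanh hρ]
    field_simp
    ring
  rw [hval] at key
  refine ((hasDerivAt_id ρ).sub key.2).congr_deriv ?_
  ring

/-! ### Closed forms for the binary and the Gaussian input -/

instance : IsProbabilityMeasure equiprobableBinary :=
  ⟨by simp [equiprobableBinary, ENNReal.inv_two_add_inv_two]⟩

lemma equiprobableBinary_prod (κ : Measure ℝ) [SFinite κ] :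
    equiprobableBinary.prod κ =
      (2⁻¹ : ℝ≥0∞) • κ.map (Prod.mk 1) + (2⁻¹ : ℝ≥0∞) • κ.map (Prod.mk (-1)) := by
  rw [equiprobableBinary, Measure.add_prod, Measure.prod_smul_left, Measure.prod_smul_left,
    Measure.dirac_prod, Measure.dirac_prod]

lemma integral_log_cosh_neg (a b : ℝ) :
    ∫ z, Real.log (Real.cosh (a + -b * z)) ∂gaussianReal 0 1 =
      ∫ z, Real.log (Real.cosh (a + b * z)) ∂gaussianReal 0 1 := by
  have h : (gaussianReal 0 1).map (fun x => -x) = gaussianReal 0 1 := by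
    rw [gaussianReal_map_neg, neg_zero]
  conv_rhs => rw [← h]
  rw [integral_map (by fun_prop) (Measurable.aestronglyMeasurable (by fun_prop))]
  simp

/-- The density with respect to `N(0, 1)` of the output of the scalar channel with equiprobable
binary input. -/
noncomputable def binaryOutputDensity (ρ y : ℝ) : ℝ := Real.exp (-(ρ / 2)) * Real.cosh (√ρ * y)

lemma lintegral_gaussianShiftDensity_binary {ρ : ℝ} (hρ : 0 < ρ) (y : ℝ) :
    ∫⁻ t, ENNReal.ofReal (gaussianShiftDensity (√ρ * t) y) ∂equiprobableBinary =
      ENNReal.ofReal (binaryOutputDensity ρ y) := by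
  have hs : √ρ ^ 2 = ρ := Real.sq_sqrt hρ.le
  rw [equiprobableBinary, lintegral_add_measure, lintegral_smul_measure, lintegral_smul_measure,
    lintegral_dirac, lintegral_dirac, smul_eq_mul, smul_eq_mul, ← mul_add,
    ← ENNReal.ofReal_add (gaussianShiftDensity_pos _ _).le (gaussianShiftDensity_pos _ _).le,
    show (2⁻¹ : ℝ≥0∞) = ENNReal.ofReal 2⁻¹ by
      rw [ENNReal.ofReal_inv_of_pos two_pos]; simp,
    ← ENNReal.ofReal_mul (by positivity)]
  congr 1
  simp only [gaussianShiftDensity, binaryOutputDensity]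
  rw [mul_one, mul_neg_one, neg_sq, hs, Real.cosh_eq, sub_eq_neg_add, sub_eq_neg_add,
    Real.exp_add, Real.exp_add, neg_mul]
  ring

lemma informationDensity_binary_one {ρ : ℝ} (hρ : 0 < ρ) (w : ℝ) :
    informationDensity √ρ (binaryOutputDensity ρ) (1, w) =
      (ρ + √ρ * w) - Real.log (Real.cosh (ρ + √ρ * w)) := by
  have hs : √ρ * √ρ = ρ := Real.mul_self_sqrt hρ.le
  have hu : √ρ * (√ρ * 1 + w) = ρ + √ρ * w := by linear_combination hs
  simp only [informationDensity, gaussianShiftDensity, binaryOutputDensity]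
  rw [hu, Real.log_exp, Real.log_mul (Real.exp_pos _).ne' (Real.cosh_pos _).ne', Real.log_exp]
  linear_combination hs / 2

lemma informationDensity_binary_neg_one {ρ : ℝ} (hρ : 0 < ρ) (w : ℝ) :
    informationDensity √ρ (binaryOutputDensity ρ) (-1, w) =
      (ρ + -√ρ * w) - Real.log (Real.cosh (ρ + -√ρ * w)) := by
  have hs : √ρ * √ρ = ρ := Real.mul_self_sqrt hρ.le
  have hu : √ρ * (√ρ * -1 + w) = -(ρ + -√ρ * w) := by linear_combination -hs
  simp only [informationDensity, gaussianShiftDensity, binaryOutputDensity]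
  rw [hu, Real.cosh_neg, Real.log_exp, Real.log_mul (Real.exp_pos _).ne' (Real.cosh_pos _).ne',
    Real.log_exp]
  linear_combination hs / 2

lemma integral_informationDensity_binary {ρ : ℝ} (hρ : 0 < ρ) :
    Integrable (informationDensity √ρ (binaryOutputDensity ρ))
        (equiprobableBinary.prod (gaussianReal 0 1)) ∧
      ∫ z, informationDensity √ρ (binaryOutputDensity ρ) z
          ∂equiprobableBinary.prod (gaussianReal 0 1) =
        ρ - ∫ z, Real.log (Real.cosh (ρ + √ρ * z)) ∂gaussianReal 0 1 := by
  have hm : Measurable (informationDensity √ρ (binaryOutputDensity ρ)) := by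
    unfold informationDensity binaryOutputDensity; fun_prop
  have hi : ∀ b : ℝ, Integrable (fun w => (ρ + b * w) - Real.log (Real.cosh (ρ + b * w)))
      (gaussianReal 0 1) := fun b =>
    (integrable_affine_gaussianReal ρ b).sub (integrable_log_cosh_affine ρ b)
  have hv : ∀ b : ℝ, ∫ w, ((ρ + b * w) - Real.log (Real.cosh (ρ + b * w))) ∂gaussianReal 0 1 =
      ρ - ∫ w, Real.log (Real.cosh (ρ + b * w)) ∂gaussianReal 0 1 := fun b => by
    rw [integral_sub (integrable_affine_gaussianReal ρ b) (integrable_log_cosh_affine ρ b),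
      integral_affine_gaussianReal]
  have h1 : Integrable (informationDensity √ρ (binaryOutputDensity ρ))
      ((gaussianReal 0 1).map (Prod.mk 1)) := by
    rw [integrable_map_measure hm.aestronglyMeasurable (by fun_prop)]
    exact (hi √ρ).congr (.of_forall fun w => (informationDensity_binary_one hρ w).symm)
  have h2 : Integrable (informationDensity √ρ (binaryOutputDensity ρ))
      ((gaussianReal 0 1).map (Prod.mk (-1))) := by
    rw [integrable_map_measure hm.aestronglyMeasurable (by fun_prop)]
    exact (hi (-√ρ)).congr (.of_forall fun w => (informationDensity_binary_neg_one hρ w).symm)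
  have h1' := h1.smul_measure (c := (2⁻¹ : ℝ≥0∞)) (by simp)
  have h2' := h2.smul_measure (c := (2⁻¹ : ℝ≥0∞)) (by simp)
  rw [equiprobableBinary_prod]
  refine ⟨h1'.add_measure h2', ?_⟩
  rw [integral_add_measure h1' h2', integral_smul_measure, integral_smul_measure,
    integral_map (by fun_prop) hm.aestronglyMeasurable,
    integral_map (by fun_prop) hm.aestronglyMeasurable]
  simp_rw [informationDensity_binary_one hρ, informationDensity_binary_neg_one hρ]
  rw [hv, hv, integral_log_cosh_neg]
  simp only [ENNReal.toReal_inv, ENNReal.toReal_ofNat, smul_eq_mul]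
  ring

/-- The density of `N(0, 1 + ρ)` with respect to `N(0, 1)`. -/
noncomputable def gaussianOutputDensity (ρ y : ℝ) : ℝ :=
  (√(1 + ρ))⁻¹ * Real.exp (ρ * y ^ 2 / (2 * (1 + ρ)))

lemma lintegral_gaussianShiftDensity_gaussian {ρ : ℝ} (hρ : 0 < ρ) (y : ℝ) :
    ∫⁻ t, ENNReal.ofReal (gaussianShiftDensity (√ρ * t) y) ∂gaussianReal 0 1 =
      ENNReal.ofReal (gaussianOutputDensity ρ y) := by
  have h1 : 0 < 1 + ρ := by linarith
  -- completing the square gives the posterior `N(√ρ y / (1 + ρ), 1 / (1 + ρ))` of the input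
  obtain ⟨v, hv⟩ : ∃ v : NNReal, (v : ℝ) = (1 + ρ)⁻¹ :=
    ⟨(1 + ρ)⁻¹.toNNReal, Real.coe_toNNReal _ (by positivity)⟩
  have hv0 : v ≠ 0 := by
    rw [← NNReal.coe_ne_zero, hv]; positivity
  have hs : √ρ ^ 2 = ρ := Real.sq_sqrt hρ.le
  have hpt : ∀ t, gaussianPDF 0 1 t * ENNReal.ofReal (gaussianShiftDensity (√ρ * t) y) =
      ENNReal.ofReal (gaussianOutputDensity ρ y) * gaussianPDF (√ρ * y / (1 + ρ)) v t := fun t => by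
    have hout : 0 ≤ gaussianOutputDensity ρ y := by unfold gaussianOutputDensity; positivity
    rw [gaussianPDF, gaussianPDF, ← ENNReal.ofReal_mul (gaussianPDFReal_nonneg _ _ _),
      ← ENNReal.ofReal_mul hout]
    congr 1
    simp only [gaussianPDFReal, gaussianShiftDensity, gaussianOutputDensity, hv,
      NNReal.coe_one, mul_one, sub_zero]
    rw [mul_assoc, ← Real.exp_add, mul_mul_mul_comm, ← Real.exp_add]
    congr 1
    · rw [Real.sqrt_mul (show 0 ≤ 2 * Real.pi by positivity), Real.sqrt_inv]
      have : √(1 + ρ) ≠ 0 := (Real.sqrt_pos.2 h1).ne'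
      field_simp
    · congr 1
      field_simp
      linear_combination (y ^ 2 - t ^ 2 * (1 + ρ)) * hs
  rw [gaussianReal_of_var_ne_zero _ one_ne_zero,
    lintegral_withDensity_eq_lintegral_mul _ (measurable_gaussianPDF _ _) (by fun_prop)]
  simp_rw [Pi.mul_apply, hpt]
  rw [lintegral_const_mul _ (measurable_gaussianPDF _ _), lintegral_gaussianPDF_eq_one _ hv0,
    mul_one]

lemma integral_informationDensity_gaussian {ρ : ℝ} (hρ : 0 < ρ) :
    Integrable (informationDensity √ρ (gaussianOutputDensity ρ))
        ((gaussianReal 0 1).prod (gaussianReal 0 1)) ∧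
      ∫ z, informationDensity √ρ (gaussianOutputDensity ρ) z
          ∂(gaussianReal 0 1).prod (gaussianReal 0 1) = Real.log (1 + ρ) / 2 := by
  have h1 : 0 < 1 + ρ := by linarith
  have hs : √ρ ^ 2 = ρ := Real.sq_sqrt hρ.le
  have hF : informationDensity √ρ (gaussianOutputDensity ρ) = fun z =>
      Real.log (1 + ρ) / 2 + ρ / (2 * (1 + ρ)) * z.1 ^ 2 - ρ / (2 * (1 + ρ)) * z.2 ^ 2 +
        √ρ / (1 + ρ) * (z.1 * z.2) := by
    ext z
    simp only [informationDensity, gaussianShiftDensity, gaussianOutputDensity]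
    rw [Real.log_exp, Real.log_mul (by positivity) (Real.exp_pos _).ne', Real.log_exp,
      Real.log_inv, Real.log_sqrt h1.le]
    field_simp
    ring_nf
    rw [hs]
    ring
  have i0 := integrable_const (μ := (gaussianReal 0 1).prod (gaussianReal 0 1))
    (Real.log (1 + ρ) / 2)
  have i1 := ((integrable_sq_gaussianReal 0 1).comp_fst (gaussianReal 0 1)).const_mul
    (ρ / (2 * (1 + ρ)))
  have i2 := ((integrable_sq_gaussianReal 0 1).comp_snd (gaussianReal 0 1)).const_mul
    (ρ / (2 * (1 + ρ)))
  have i3 := ((integrable_id_gaussianReal 0 1).mul_prod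
    (integrable_id_gaussianReal 0 1)).const_mul (√ρ / (1 + ρ))
  rw [hF]
  refine ⟨((i0.add i1).sub i2).add i3, ?_⟩
  rw [integral_add (by exact (i0.add i1).sub i2) i3, integral_sub (by exact i0.add i1) i2,
    integral_add i0 i1]
  simp only [integral_const_mul]
  rw [integral_fun_fst (fun z : ℝ => z ^ 2), integral_fun_snd (fun z : ℝ => z ^ 2),
    integral_prod_mul (fun z : ℝ => z) (fun z : ℝ => z), integral_id_gaussianReal]
  simp

lemma mutualInformation_binary {Ω : Type*} [MeasurableSpace Ω] {P : Measure Ω}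
    [IsProbabilityMeasure P] {n : ℕ} {x w : Ω → EuclideanSpace ℝ (Fin n)}
    (hx : HasLaw x (euclideanPi n equiprobableBinary) P)
    (hw : HasLaw w (stdGaussian (EuclideanSpace ℝ (Fin n))) P) (hxw : IndepFun x w P)
    {ρ : ℝ} (hρ : 0 < ρ) :
    mutualInformation P x (gaussianChannelOutput ρ x w) ≠ ∞ ∧
      (mutualInformation P x (gaussianChannelOutput ρ x w)).toReal =
        n * (ρ - ∫ z, Real.log (Real.cosh (ρ + √ρ * z)) ∂gaussianReal 0 1) := by
  have h := integral_informationDensity_binary hρ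
  rw [← h.2]
  exact mutualInformation_gaussianChannelOutput hx hw hxw ρ
    (by unfold binaryOutputDensity; fun_prop)
    (fun y => mul_pos (Real.exp_pos _) (Real.cosh_pos _))
    (lintegral_gaussianShiftDensity_binary hρ) h.1

lemma mutualInformation_gaussian {Ω : Type*} [MeasurableSpace Ω] {P : Measure Ω}
    [IsProbabilityMeasure P] {n : ℕ} {x w : Ω → EuclideanSpace ℝ (Fin n)}
    (hx : HasLaw x (stdGaussian (EuclideanSpace ℝ (Fin n))) P)
    (hw : HasLaw w (stdGaussian (EuclideanSpace ℝ (Fin n))) P) (hxw : IndepFun x w P)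
    {ρ : ℝ} (hρ : 0 < ρ) :
    mutualInformation P x (gaussianChannelOutput ρ x w) ≠ ∞ ∧
      (mutualInformation P x (gaussianChannelOutput ρ x w)).toReal =
        n * (Real.log (1 + ρ) / 2) := by
  have h := integral_informationDensity_gaussian hρ
  rw [← h.2]
  have h1 : 0 < 1 + ρ := by linarith
  exact mutualInformation_gaussianChannelOutput
    (by rwa [euclideanPi, map_pi_eq_stdGaussian]) hw hxw ρ
    (by unfold gaussianOutputDensity; fun_prop)
    (fun y => by unfold gaussianOutputDensity; positivity)
    (lintegral_gaussianShiftDensity_gaussian hρ) h.1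

/-! ### Comparison of the derivatives -/

theorem proposition10 {Ω : Type*} [MeasurableSpace Ω] (P : Measure Ω) [IsProbabilityMeasure P]
    (n : ℕ) (x x' w : Ω → EuclideanSpace ℝ (Fin n))
    -- the components of `x` are independent, equiprobable on `{1, -1}`
    (hx : ∀ i, HasLaw (fun ω => x ω i) equiprobableBinary P)
    (hx_indep : iIndepFun (fun i ω => x ω i) P)
    -- `x'` and `w` are standard Gaussian vectors
    (hx' : HasLaw x' (stdGaussian (EuclideanSpace ℝ (Fin n))) P)
    (hw : HasLaw w (stdGaussian (EuclideanSpace ℝ (Fin n))) P)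
    -- `w` is independent of `x` and of `x'`
    (hxw : IndepFun x w P) (hx'w : IndepFun x' w P) :
    ∀ ρ : ℝ, 0 < ρ →
      mutualInformation P x (gaussianChannelOutput ρ x w) ≠ ∞ ∧
      mutualInformation P x' (gaussianChannelOutput ρ x' w) ≠ ∞ ∧
      DifferentiableAt ℝ
        (fun r : ℝ => (mutualInformation P x (gaussianChannelOutput r x w)).toReal) ρ ∧
      DifferentiableAt ℝ
        (fun r : ℝ => (mutualInformation P x' (gaussianChannelOutput r x' w)).toReal) ρ ∧
      deriv (fun r : ℝ => (mutualInformation P x (gaussianChannelOutput r x w)).toReal) ρ ≤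
        deriv (fun r : ℝ => (mutualInformation P x' (gaussianChannelOutput r x' w)).toReal) ρ := by
  intro ρ hρ
  have hxlaw : HasLaw x (euclideanPi n equiprobableBinary) P :=
    HasLaw.fun_comp (Y := WithLp.toLp 2) ⟨by fun_prop, rfl⟩ (hx_indep.hasLaw_pi hx)
  have hd := (hasDerivAt_binary_information hρ).const_mul (n : ℝ)
  have hd' : HasDerivAt (fun r : ℝ => n * (Real.log (1 + r) / 2)) (n * (1 / (1 + ρ) / 2)) ρ :=
    ((((hasDerivAt_id ρ).const_add 1).log (by simp; linarith)).div_const 2).const_mul _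
  replace hd := hd.congr_of_eventuallyEq <| Filter.eventually_of_mem (Ioi_mem_nhds hρ) fun r hr =>
    (mutualInformation_binary hxlaw hw hxw hr).2
  replace hd' := hd'.congr_of_eventuallyEq <| Filter.eventually_of_mem (Ioi_mem_nhds hρ) fun r hr =>
    (mutualInformation_gaussian hx' hw hx'w hr).2
  refine ⟨(mutualInformation_binary hxlaw hw hxw hρ).1,
    (mutualInformation_gaussian hx' hw hx'w hρ).1, hd.differentiableAt, hd'.differentiableAt, ?_⟩
  rw [hd.deriv, hd'.deriv]
  have h := div_one_add_le_integral_tanh hρ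
  have h1 : 1 / (1 + ρ) = 1 - ρ / (1 + ρ) := by field_simp; ring
  gcongr
  linarith
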